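/- **Model.** A *system* consists of a finite set $\Pi\subset\mathbb N$ of processes (identified by their IDs), a set $F\subseteq\Pi$ of faulty processes, with $C=\Pi\setminus F$ the correct ones, and for each $i\in\Pi$ a set $PD_i\subseteq\Pi$ (the output of its participant detector). The knowledge connectivity graph has vertex set $\Pi$ and an edge $(i,j)$ iff $j\in PD_i$; its *safe subgraph* $G_{\mathrm{safe}}$ is the subgraph induced on $C$. A directed graph is $k$-strongly connected if between any two distinct vertices, in either direction, there are at least $k$ node-disjoint directed paths (paths sharing only their end points). It belongs to *$k$-OSR PD* if its underlying undirected graph is connected, exactly one of its strongly connected components is a sink (no path leaves it), this sink component is $k$-strongly connected, and there are at least $k$ node-disjoint paths from every vertex outside the sink to every vertex of the sink. For $f\in\mathbb N$, the system satisfies *the BFT-CUP requirements for fault threshold $f$* if $G_{\mathrm{safe}}$ belongs to $(f+1)$-OSR PD and its sink component has at least $2f+1$ processes. A *protocol* is a deterministic message-driven and clock-driven state machine run by every process. The initial state of process $i$ depends only on $i$, $PD_i$ and the value that $i$ proposes (so neither $\Pi$ nor $F$ nor the fault threshold is known). Time is discrete, and at each tick a process takes a step, receiving the messages delivered to it at that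 tick and possibly sending messages. Channels are authenticated and reliable (every message is delivered exactly once, unaltered, after a finite delay); digital signatures cannot be forged. A process following the protocol can send messages only to processes it knows: itself, the members of $PD_i$, and those it has discovered through the messages it received. The system is *partially synchronous*: in each execution there are a time GST and a duration $\delta$, both unknown, such that messages between correct processes sent from GST on are delayed by at most $\delta$. Correct processes follow the protocol. Faulty processes are either *Byzantine* (they know everything, collude and behave arbitrarily, but cannot forge signatures of correct processes) or, in the *crash* model, follow the protocol until they stop at some time. Let $V$ be a set of values with a predicate $\mathtt{valid}$. A protocol *solves consensus* in a system if in each of its executions in which all correct processes propose valid values: every value decided by a correct process is valid and was proposed by some process, where a Byzantine process counts as proposing any value (Validity); correct processes never decide different values (Agreement); every correct process eventually decides (Termination). **Theorem.** Suppose that there are at least two valid values. Then no protocol solves Byzantine consensus in all partially synchronous systems that, for some $f\in\mathbb N$ unknown to the processes, satisfy $|F|\le f$ and the BFT-CUP requirements for fault threshold $f$. The same holds for crash faults in place of Byzantine faults. -/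

import Mathlib

universe u v

namespace CUP

/-! ### Directed graphs: node-disjoint paths, sink components, `k`-OSR -/

section Graphs

variable {W : Type*}

/-- The subgraph of `G` induced on the vertex set `T`. -/
def induceOn (G : Digraph W) (T : Set W) : Digraph T where
  Adj i j := G.Adj i j

/-- `l` is the list of vertices of a (simple, directed) path from `i` to `j` in `G`. -/
def IsPath (G : Digraph W) (i j : W) (l : List W) : Prop :=
  l.head? = some i ∧ l.getLast? = some j ∧ l.IsChain G.Adj ∧ l.Nodup

/-- There are (at least) `k` node-disjoint paths from `i` to `j`: `k` distinct paths, any two of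
which have only their end points `i` and `j` in common. -/
def HasDisjointPaths (G : Digraph W) (k : ℕ) (i j : W) : Prop :=
  ∃ path : Fin k → List W, Function.Injective path ∧ (∀ a, IsPath G i j (path a)) ∧
    ∀ a b, a ≠ b → ∀ x, x ∈ path a → x ∈ path b → x = i ∨ x = j

/-- Every vertex reaches every other vertex through at least `k` node-disjoint paths. -/
def IsKStronglyConnected (G : Digraph W) (k : ℕ) : Prop :=
  ∀ i j, i ≠ j → HasDisjointPaths G k i j

/-- `j` is reachable from `i` along a (possibly empty) directed path. -/
def Reach (G : Digraph W) : W → W → Prop := Relation.ReflTransGen G.Adj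

/-- The strongly connected component of `i`. -/
def scc (G : Digraph W) (i : W) : Set W := {j | Reach G i j ∧ Reach G j i}

/-- `T` is a sink component: a strongly connected component that no directed path leaves. -/
def IsSinkComponent (G : Digraph W) (T : Set W) : Prop :=
  (∃ i, T = scc G i) ∧ ∀ i ∈ T, ∀ j, Reach G i j → j ∈ T

/-- `G` belongs to `k`-One Sink Reducibility (`k`-OSR) PD. -/
def IsOSR (G : Digraph W) (k : ℕ) : Prop :=
  G.toSimpleGraphInclusive.Connected ∧
  (∃! T, IsSinkComponent G T) ∧
  ∀ T, IsSinkComponent G T →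
    IsKStronglyConnected (induceOn G T) k ∧ ∀ i ∉ T, ∀ j ∈ T, HasDisjointPaths G k i j

end Graphs

/-! ### Systems and the requirements of the BFT-CUP model -/

/-- A system: a finite set of participants with identifiers in `ℕ` (not necessarily consecutive),
the set of those which are faulty, and the set `pd i` of participants returned by the participant
detector of `i`. -/
structure System where
  procs : Finset ℕ
  faulty : Finset ℕ
  pd : ℕ → Finset ℕ
  faulty_subset : faulty ⊆ procs
  pd_subset : ∀ i ∈ procs, pd i ⊆ procs

namespace System

/-- The set of correct participants. -/
def correct (S : System) : Finset ℕ := S.procs \ S.faulty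

/-- The subgraph induced on `T` of the knowledge connectivity graph, which has an edge from `i` to
`j` iff `j ∈ pd i`; for `T = procs` it is the whole knowledge connectivity graph. -/
def knowledgeGraph (S : System) (T : Finset ℕ) : Digraph {i // i ∈ T} where
  Adj i j := (j : ℕ) ∈ S.pd i

/-- The safe subgraph: the knowledge connectivity graph without the faulty participants. -/
def safeGraph (S : System) : Digraph {i // i ∈ S.correct} := S.knowledgeGraph S.correct

/-- The knowledge connectivity graph satisfies the requirements of the BFT-CUP model for the
fault threshold `f`. -/
def SatisfiesBFTCUP (S : System) (f : ℕ) : Prop :=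
  IsOSR S.safeGraph (f + 1) ∧ ∀ T, IsSinkComponent S.safeGraph T → 2 * f + 1 ≤ T.ncard

end System

/-! ### Messages with digital signatures -/

/-- Messages: application data, identifiers of participants, pairs, and messages signed by a
participant. -/
inductive Msg (D : Type v) : Type v
  | data (d : D) : Msg D
  | ident (p : ℕ) : Msg D
  | pair (m₁ m₂ : Msg D) : Msg D
  | signed (p : ℕ) (m : Msg D) : Msg D

namespace Msg

variable {D : Type v}

/-- The identifiers which a message discloses. -/
def ids : Msg D → Set ℕ
  | data _ => ∅
  | ident p => {p}
  | pair m₁ m₂ => m₁.ids ∪ m₂.ids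
  | signed p m => {p} ∪ m.ids

/-- The signatures contained in a message: `(p, m)` stands for the signature of `p` on `m`. -/
def signatures : Msg D → Set (ℕ × Msg D)
  | data _ => ∅
  | ident _ => ∅
  | pair m₁ m₂ => m₁.signatures ∪ m₂.signatures
  | signed p m => {(p, m)} ∪ m.signatures

end Msg

/-! ### Protocols and their executions -/

/-- A deterministic protocol for consensus on values in `V`. The initial state of a participant
depends only on its identifier, on the output of its participant detector and on the value it
proposes; in particular on neither the set of participants nor the fault threshold. At each tick
a participant takes a step: from its state and the multiset of (sender, message) pairs delivered to
it at this tick it computes its next state and a set of (addressee, message) pairs to send. -/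
structure Protocol (V : Type u) where
  Data : Type v
  State : Type v
  start : (self : ℕ) → (pd : Finset ℕ) → (proposal : V) → State
  step : State → Multiset (ℕ × Msg Data) → State × Finset (ℕ × Msg Data)
  decision : State → Option V

/-- The kinds of faults: Byzantine (arbitrary behaviour) or crash. -/
inductive FaultModel
  | byzantine
  | crash

/-- The record of a run: the proposals, the state of each participant at each tick, the
(addressee, message) pairs it puts on its channels at each tick, and the transmission delay of each
of them. Every message arrives, after a positive and finite delay, exactly once and
unaltered: the channels are reliable. -/
structure Run {V : Type u} (P : Protocol.{u, v} V) where
  proposal : ℕ → V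
  state : ℕ → ℕ → P.State
  sent : ℕ → ℕ → Finset (ℕ × Msg P.Data)
  delay : ℕ → ℕ → ℕ × Msg P.Data → ℕ+

namespace Run

variable {V : Type u} {P : Protocol.{u, v} V} (R : Run P) (S : System)

open Classical in
/-- The (sender, message) pairs delivered to `j` at tick `t`: the messages to `j` sent by some
participant `i` at a tick `s` with `s + delay = t`. The sender is authenticated. -/
noncomputable def inbox (j t : ℕ) : Multiset (ℕ × Msg P.Data) :=
  ∑ s ∈ Finset.range t, ∑ i ∈ S.procs,
    ((R.sent i s).filter fun q => q.1 = j ∧ s + (R.delay i s q : ℕ) = t).val.map fun q => (i, q.2)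

/-- The (sender, message) pairs delivered to `j` up to tick `t`. -/
def received (j t : ℕ) : Set (ℕ × Msg P.Data) := {x | ∃ s ≤ t, x ∈ R.inbox S j s}

/-- The participants known to `j` at tick `t`: `j` itself, those returned by its participant
detector, and those discovered through the messages it has received. -/
def known (j t : ℕ) : Set ℕ :=
  {p | p = j ∨ p ∈ S.pd j ∨ ∃ x ∈ R.received S j t, p = x.1 ∨ p ∈ x.2.ids}

/-- Unforgeability of signatures: the members of `K` together can produce `m` at tick `t`, because
every signature in `m` is by a member of `K` or occurs in a message that one of them received. -/
def CanProduce (K : Set ℕ) (t : ℕ) (m : Msg P.Data) : Prop :=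
  ∀ σ ∈ m.signatures, σ.1 ∈ K ∨ ∃ k ∈ K, ∃ x ∈ R.received S k t, σ ∈ x.2.signatures

open Classical in
/-- What `i` sends at tick `t` when it follows the protocol: only messages that it can produce go
out, and only to participants that it knows. -/
noncomputable def prescribed (i t : ℕ) : Finset (ℕ × Msg P.Data) :=
  (P.step (R.state i t) (R.inbox S i t)).2.filter fun q =>
    q.1 ∈ R.known S i t ∧ R.CanProduce S {i} t q.2

/-- `i` starts in the initial state that the protocol prescribes. -/
def StartsCorrectly (i : ℕ) : Prop := R.state i 0 = P.start i (S.pd i) (R.proposal i)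

/-- `i` follows the protocol at tick `t`. -/
def FollowsAt (i t : ℕ) : Prop :=
  R.state i (t + 1) = (P.step (R.state i t) (R.inbox S i t)).1 ∧ R.sent i t = R.prescribed S i t

/-- `i` follows the protocol forever. -/
def BehavesCorrectly (i : ℕ) : Prop := R.StartsCorrectly S i ∧ ∀ t, R.FollowsAt S i t

/-- `i` follows the protocol until it crashes at some tick `c`, at which it may still send a part
of the messages prescribed for that tick. -/
def Crashes (i : ℕ) : Prop :=
  R.StartsCorrectly S i ∧
    ∃ c, (∀ t < c, R.FollowsAt S i t) ∧ R.sent i c ⊆ R.prescribed S i c ∧ ∀ t > c, R.sent i t = ∅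

/-- A Byzantine `i` sends anything to anybody, in collusion with the other faulty participants; it
only cannot forge the signatures of correct participants. -/
def BehavesByzantine (i : ℕ) : Prop :=
  ∀ t, ∀ q ∈ R.sent i t, R.CanProduce S (S.faulty : Set ℕ) t q.2

/-- The behaviour allowed to a faulty participant. -/
def BehavesFaulty (fm : FaultModel) (i : ℕ) : Prop :=
  match fm with
  | .byzantine => R.BehavesByzantine S i
  | .crash => R.Crashes S i

/-- Partial synchrony: there are a time `gst` and a duration `δ` such that messages between correct
participants sent from `gst` on take at most `δ`. -/
def PartiallySynchronous : Prop :=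
  ∃ gst δ : ℕ, ∀ i ∈ S.correct, ∀ j ∈ S.correct, ∀ t ≥ gst, ∀ m, (j, m) ∈ R.sent i t →
    (R.delay i t (j, m) : ℕ) ≤ δ

/-- `R` is an execution of the protocol in the partially synchronous system `S`. -/
structure IsExecution (fm : FaultModel) : Prop where
  correct : ∀ i ∈ S.correct, R.BehavesCorrectly S i
  faulty : ∀ i ∈ S.faulty, R.BehavesFaulty S fm i
  partiallySynchronous : R.PartiallySynchronous S

/-- `i` decides the value `d`. -/
def Decides (i : ℕ) (d : V) : Prop := ∃ t, P.decision (R.state i t) = some d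

/-- `p` proposes the value `d`. What a Byzantine participant proposes is not determined by its
input: it counts as proposing any value. -/
def Proposes (fm : FaultModel) (p : ℕ) (d : V) : Prop :=
  R.proposal p = d ∨ (fm = .byzantine ∧ p ∈ S.faulty)

/-- Validity, Agreement and Termination. -/
structure SatisfiesConsensus (valid : V → Prop) (fm : FaultModel) : Prop where
  validity : ∀ i ∈ S.correct, ∀ d, R.Decides i d → valid d ∧ ∃ p ∈ S.procs, R.Proposes S fm p d
  agreement : ∀ i ∈ S.correct, ∀ j ∈ S.correct, ∀ d e, R.Decides i d → R.Decides j e → d = e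
  termination : ∀ i ∈ S.correct, ∃ d, R.Decides i d

end Run

/-- The protocol solves consensus in the system `S`: each of its executions in which all correct
participants propose valid values satisfies Validity, Agreement and Termination. -/
def Protocol.SolvesConsensus {V : Type u} (P : Protocol.{u, v} V) (valid : V → Prop)
    (fm : FaultModel) (S : System) : Prop :=
  ∀ R : Run P, R.IsExecution S fm → (∀ i ∈ S.correct, valid (R.proposal i)) →
    R.SatisfiesConsensus S valid fm

end CUP

/-! A participant that ignores the fault threshold cannot tell a silent participant from a slow one.
In a group of four with threshold 1 whose faulty member is silent, the other three must decide. The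
same three also live among six correct participants that meet the requirements for threshold 0. If
messages between the two halves are slow enough there, each half sees exactly its solo run
(`IsolatedUntil.state_eq`, `merged_state_eq_solo`) and decides alone.

Validity in the solo run does not fix the decided value, since a Byzantine member counts as
proposing anything. It is fixed by replaying the solo run inside the six-member system with
unanimous proposals, where nobody is faulty (`decides_eq_of_merged`). With `a` proposed on one side
and `b` on the other, Agreement then fails. Silence is both a crash and a Byzantine behaviour, so
one argument serves both fault models. -/

namespace CUP

/-! ### Knowledge graphs with a single strongly connected component -/

section Graphs

variable {W : Type*} {G : Digraph W}

theorem IsPath.map {W' : Type*} {G' : Digraph W'} {e : W → W'} (he : Function.Injective e)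
    (hadj : ∀ i j, G.Adj i j → G'.Adj (e i) (e j)) {i j : W} {l : List W} (h : IsPath G i j l) :
    IsPath G' (e i) (e j) (l.map e) := by
  obtain ⟨h1, h2, h3, h4⟩ := h
  refine ⟨by simp [h1], by simp [h2], ?_, h4.map he⟩
  rw [List.isChain_map]
  exact h3.imp fun a b => hadj a b

theorem HasDisjointPaths.map {W' : Type*} {G' : Digraph W'} {e : W → W'}
    (he : Function.Injective e) (hadj : ∀ i j, G.Adj i j → G'.Adj (e i) (e j)) {k : ℕ} {i j : W}
    (h : HasDisjointPaths G k i j) : HasDisjointPaths G' k (e i) (e j) := by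
  obtain ⟨path, hinj, hpath, hdis⟩ := h
  refine ⟨fun a => (path a).map e, fun a b hab => hinj (List.map_injective_iff.2 he hab),
    fun a => (hpath a).map he hadj, fun a b hab x hx hx' => ?_⟩
  obtain ⟨y, hy, rfl⟩ := List.mem_map.1 hx
  obtain ⟨z, hz, hzy⟩ := List.mem_map.1 hx'
  obtain rfl := he hzy
  exact (hdis a b hab z hy hz).imp (congrArg e) (congrArg e)

theorem isPath_pair {i j : W} (hij : i ≠ j) (h : G.Adj i j) : IsPath G i j [i, j] := by
  simp [IsPath, hij, h]

theorem isPath_triple {i h j : W} (hih : i ≠ h) (hhj : h ≠ j) (hij : i ≠ j) (h₁ : G.Adj i h)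
    (h₂ : G.Adj h j) : IsPath G i j [i, h, j] := by
  simp [IsPath, hij, hih, hhj, h₁, h₂]

theorem IsPath.hasDisjointPaths_one {i j : W} {l : List W} (h : IsPath G i j l) :
    HasDisjointPaths G 1 i j :=
  ⟨fun _ => l, Function.injective_of_subsingleton _, fun _ => h,
    fun a b hab => (hab (Subsingleton.elim a b)).elim⟩

theorem hasDisjointPaths_two {i h j : W} (hih : i ≠ h) (hhj : h ≠ j) (hij : i ≠ j)
    (h₀ : G.Adj i j) (h₁ : G.Adj i h) (h₂ : G.Adj h j) : HasDisjointPaths G 2 i j := by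
  refine ⟨![[i, j], [i, h, j]], ?_, ?_, ?_⟩
  · intro a b
    fin_cases a <;> fin_cases b <;> simp
  · intro a
    fin_cases a
    · exact isPath_pair hij h₀
    · exact isPath_triple hih hhj hij h₁ h₂
  · intro a b hab x
    fin_cases a <;> fin_cases b <;> simp_all

theorem IsPath.reach {i j : W} {l : List W} (h : IsPath G i j l) : Reach G i j := by
  obtain ⟨h1, h2, h3, -⟩ := h
  induction l generalizing i with
  | nil => simp at h1
  | cons x l ih =>
    obtain rfl : x = i := by simpa using h1
    cases l with
    | nil =>
      obtain rfl : x = j := by simpa using h2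
      exact Relation.ReflTransGen.refl
    | cons y l =>
      rw [List.isChain_cons_cons] at h3
      exact Relation.ReflTransGen.head h3.1 (ih (by simp) (by simpa using h2) h3.2)

theorem Reach.reachable {i j : W} (h : Reach G i j) : G.toSimpleGraphInclusive.Reachable i j := by
  induction h with
  | refl => exact SimpleGraph.Reachable.refl _
  | @tail b c _ hbc ih =>
    by_cases hne : b = c
    · exact hne ▸ ih
    · refine ih.trans (SimpleGraph.Adj.reachable ?_)
      simp [Digraph.toSimpleGraphInclusive, SimpleGraph.fromRel_adj, hne, hbc]

theorem IsKStronglyConnected.reach {k : ℕ} (h : IsKStronglyConnected G (k + 1)) (i j : W) :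
    Reach G i j := by
  by_cases hij : i = j
  · exact hij ▸ Relation.ReflTransGen.refl
  · obtain ⟨path, -, hpath, -⟩ := h i j hij
    exact (hpath 0).reach

theorem IsKStronglyConnected.isSinkComponent_iff [Nonempty W] {k : ℕ}
    (h : IsKStronglyConnected G (k + 1)) {T : Set W} : IsSinkComponent G T ↔ T = Set.univ := by
  have hscc (i : W) : scc G i = Set.univ := Set.eq_univ_of_forall fun j => ⟨h.reach i j, h.reach j i⟩
  constructor
  · rintro ⟨⟨i, rfl⟩, -⟩
    exact hscc i
  · rintro rfl
    exact ⟨⟨Classical.arbitrary W, (hscc _).symm⟩, fun _ _ _ _ => trivial⟩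

theorem IsKStronglyConnected.isOSR [Nonempty W] {k : ℕ} (h : IsKStronglyConnected G (k + 1)) :
    IsOSR G (k + 1) := by
  refine ⟨(SimpleGraph.connected_iff _).2 ⟨fun i j => (h.reach i j).reachable, inferInstance⟩,
    ⟨Set.univ, h.isSinkComponent_iff.2 rfl, fun T hT => h.isSinkComponent_iff.1 hT⟩, fun T hT => ?_⟩
  obtain rfl := h.isSinkComponent_iff.1 hT
  refine ⟨fun i j hij => ?_, fun i hi => (hi trivial).elim⟩
  exact (h i j (Subtype.coe_injective.ne hij)).map (e := fun x => (⟨x, trivial⟩ : (Set.univ : Set W)))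
    (fun x y hxy => congrArg Subtype.val hxy) fun _ _ hadj => hadj

end Graphs

/-- The sink is then the whole safe graph, so its size is the number of correct participants and
nothing lies outside it. -/
theorem System.satisfiesBFTCUP_of_isKStronglyConnected {S : System} {f : ℕ}
    (h : IsKStronglyConnected S.safeGraph (f + 1)) (hcard : 2 * f + 1 ≤ S.correct.card) :
    S.SatisfiesBFTCUP f := by
  have hne : Nonempty {i // i ∈ S.correct} :=
    (Finset.card_pos.1 (by omega : 0 < S.correct.card)).to_subtype
  refine ⟨h.isOSR, fun T hT => ?_⟩
  rw [h.isSinkComponent_iff.1 hT, Set.ncard_univ]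
  simpa using hcard

/-! ### Two overlapping groups of participants -/

/-- The participants `Q`, all of which know `Q`, and of which only `x` is faulty. -/
def soloSystem (Q : Finset ℕ) (x : ℕ) (hx : x ∈ Q) : System where
  procs := Q
  faulty := {x}
  pd _ := Q
  faulty_subset := by simpa using hx
  pd_subset _ _ := subset_rfl

/-- The three correct members form a complete digraph: the two disjoint paths are the direct edge
and the detour through the third member. -/
theorem soloSystem_satisfiesBFTCUP {Q : Finset ℕ} {x : ℕ} (hx : x ∈ Q) (hQ : Q.card = 4) :
    (soloSystem Q x hx).SatisfiesBFTCUP 1 := by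
  have hcard : (soloSystem Q x hx).correct.card = 3 := by
    simp [System.correct, soloSystem, Finset.sdiff_singleton_eq_erase, Finset.card_erase_of_mem hx,
      hQ]
  refine System.satisfiesBFTCUP_of_isKStronglyConnected (fun i j hij => ?_) hcard.ge
  have hadj (a b : {i // i ∈ (soloSystem Q x hx).correct}) :
      (soloSystem Q x hx).safeGraph.Adj a b := (Finset.mem_sdiff.1 b.2).1
  obtain ⟨h, hh⟩ : ∃ h, h ∉ ({i, j} : Finset {i // i ∈ (soloSystem Q x hx).correct}) := by
    by_contra! hall
    have h1 := Finset.card_le_card (fun h _ => hall h : Finset.univ ⊆ _)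
    have h2 := Finset.card_le_two (a := i) (b := j)
    simp only [Finset.card_univ, Fintype.card_coe, hcard] at h1
    omega
  simp only [Finset.mem_insert, Finset.mem_singleton, not_or] at hh
  exact hasDisjointPaths_two (Ne.symm hh.1) hh.2 hij (hadj i j) (hadj i h) (hadj h j)

/-- The participants `0, …, 5`, all correct, of which `0`, `1`, `2` know each other and `3`, and
`3`, `4`, `5` know each other and `0`. -/
def mergedSystem : System where
  procs := Finset.range 6
  faulty := ∅
  pd i := if i < 3 then {0, 1, 2, 3} else {0, 3, 4, 5}
  faulty_subset := by simp
  pd_subset i _ := by split_ifs <;> decide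

theorem mergedSystem_correct : mergedSystem.correct = Finset.range 6 := by
  simp [System.correct, mergedSystem]

/-- Threshold 0 asks for a single path. Participants `3` and `0` bridge the halves, one in each
direction, so two edges always suffice. -/
theorem mergedSystem_satisfiesBFTCUP : mergedSystem.SatisfiesBFTCUP 0 := by
  refine System.satisfiesBFTCUP_of_isKStronglyConnected (fun i j hij => ?_)
    (by simp [mergedSystem_correct])
  have key : ∀ i ∈ Finset.range 6, ∀ j ∈ Finset.range 6, i ≠ j → j ∈ mergedSystem.pd i ∨
      ∃ h ∈ Finset.range 6, i ≠ h ∧ h ≠ j ∧ h ∈ mergedSystem.pd i ∧ j ∈ mergedSystem.pd h := by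
    decide
  obtain ⟨i, hi⟩ := i
  obtain ⟨j, hj⟩ := j
  have hij' : i ≠ j := fun h => hij (Subtype.ext h)
  rw [mergedSystem_correct] at hi hj
  rcases key i hi j hj hij' with h | ⟨h, hh, h1, h2, h3, h4⟩
  · exact (isPath_pair hij h).hasDisjointPaths_one
  · exact (isPath_triple (h := ⟨h, mergedSystem_correct ▸ hh⟩) (by simpa using h1) (by simpa using h2)
      hij h3 h4).hasDisjointPaths_one

/-! ### Existence of executions with silent faulty participants -/

namespace Run

variable {V : Type u} {P : Protocol.{u, v} V}

theorem inbox_congr {R R' : Run P} {S : System} {t : ℕ} (hdelay : R.delay = R'.delay)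
    (hsent : ∀ s < t, ∀ i, R.sent i s = R'.sent i s) (j : ℕ) : R.inbox S j t = R'.inbox S j t := by
  unfold inbox
  refine Finset.sum_congr rfl fun s hs => Finset.sum_congr rfl fun i _ => ?_
  rw [hsent s (Finset.mem_range.1 hs), hdelay]

open Classical in
-- Sending depends only on local data, which is what lets runs of different systems be compared.
theorem prescribed_congr {R R' : Run P} {S S' : System} {i t : ℕ} (hpd : S.pd i = S'.pd i)
    (hstate : R.state i t = R'.state i t) (hinbox : ∀ s ≤ t, R.inbox S i s = R'.inbox S' i s) :
    R.prescribed S i t = R'.prescribed S' i t := by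
  have hrec : R.received S i t = R'.received S' i t := by
    ext x
    exact exists_congr fun s => and_congr_right fun hs => by rw [hinbox s hs]
  have hknown : R.known S i t = R'.known S' i t := by simp only [known, hrec, hpd]
  have hprod (m : Msg P.Data) : R.CanProduce S {i} t m ↔ R'.CanProduce S' {i} t m := by
    simp only [CanProduce, Set.mem_singleton_iff, exists_eq_left, hrec]
  simp only [prescribed, hstate, hinbox t le_rfl]
  refine Finset.filter_congr fun q _ => ?_
  rw [hknown, hprod]

/-- The run up to tick `t` in which the correct participants follow the protocol and the faulty ones
are silent. -/
noncomputable def silentStage (S : System) (proposal : ℕ → V)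
    (delay : ℕ → ℕ → ℕ × Msg P.Data → ℕ+) : ℕ → Run P
  | 0 => ⟨proposal, fun i _ => P.start i (S.pd i) (proposal i), fun _ _ => ∅, delay⟩
  | t + 1 =>
    let R := silentStage S proposal delay t
    { proposal := proposal
      state := fun i s => if s ≤ t then R.state i s else (P.step (R.state i t) (R.inbox S i t)).1
      sent := fun i s => if s = t then if i ∈ S.correct then R.prescribed S i t else ∅ else R.sent i s
      delay := delay }

/-- The run in which the correct participants follow the protocol and the faulty ones are silent. -/
noncomputable def silent (S : System) (proposal : ℕ → V)
    (delay : ℕ → ℕ → ℕ × Msg P.Data → ℕ+) : Run P where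
  proposal := proposal
  state i t := (silentStage S proposal delay t).state i t
  -- Stage `t` knows the states at tick `t`; the messages of that tick are first recorded at stage
  -- `t + 1`.
  sent i t := (silentStage S proposal delay (t + 1)).sent i t
  delay := delay

section Silent

variable (S : System) (proposal : ℕ → V) (delay : ℕ → ℕ → ℕ × Msg P.Data → ℕ+)

theorem silentStage_delay (t : ℕ) : (silentStage S proposal delay t).delay = delay := by
  cases t <;> rfl

theorem silentStage_sent {s t : ℕ} (hst : s < t) (i : ℕ) :
    (silentStage S proposal delay t).sent i s = (silent S proposal delay).sent i s := by
  induction t, Nat.succ_le_of_lt hst using Nat.le_induction with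
  | base => rfl
  | succ t ht ih =>
    rw [← ih (by omega)]
    exact if_neg (by omega)

theorem silent_inbox {s t : ℕ} (hst : s ≤ t) (i : ℕ) :
    (silentStage S proposal delay t).inbox S i s = (silent S proposal delay).inbox S i s :=
  inbox_congr (silentStage_delay S proposal delay t)
    (fun _ hr i => silentStage_sent S proposal delay (hr.trans_le hst) i) i

theorem silent_sent (i t : ℕ) : (silent S proposal delay).sent i t =
    if i ∈ S.correct then (silent S proposal delay).prescribed S i t else ∅ := by
  have h : (silentStage S proposal delay t).prescribed S i t =
      (silent S proposal delay).prescribed S i t :=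
    prescribed_congr rfl rfl fun s hs => silent_inbox S proposal delay hs i
  rw [← h]
  exact if_pos rfl

theorem silent_behavesCorrectly {i : ℕ} (hi : i ∈ S.correct) :
    (silent S proposal delay).BehavesCorrectly S i := by
  refine ⟨rfl, fun t => ⟨?_, (silent_sent S proposal delay i t).trans (if_pos hi)⟩⟩
  rw [← silent_inbox S proposal delay le_rfl]
  exact if_neg (by omega)

theorem silent_sent_of_faulty {i : ℕ} (hi : i ∈ S.faulty) (t : ℕ) :
    (silent S proposal delay).sent i t = ∅ :=
  (silent_sent S proposal delay i t).trans (if_neg fun h => (Finset.mem_sdiff.1 h).2 hi)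

theorem silent_isExecution (fm : FaultModel) {δ : ℕ} (hδ : ∀ i t q, (delay i t q : ℕ) ≤ δ) :
    (silent S proposal delay).IsExecution S fm where
  correct _ hi := silent_behavesCorrectly S proposal delay hi
  faulty i hi := by
    have hsent := silent_sent_of_faulty S proposal delay hi
    cases fm with
    | byzantine =>
      intro t q hq
      simp [hsent] at hq
    -- Silence is a crash at tick 0 with none of the prescribed messages sent.
    | crash => exact ⟨rfl, 0, by simp, by simp [hsent], fun t _ => hsent t⟩
  partiallySynchronous := ⟨0, δ, fun i _ j _ t _ m _ => hδ i t (j, m)⟩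

end Silent

/-! ### Indistinguishability -/

/-- No message from outside `A` reaches a member of `A` up to tick `T`. -/
def IsolatedUntil (R : Run P) (S : System) (A : Finset ℕ) (T : ℕ) : Prop :=
  ∀ i ∈ S.procs, i ∉ A → ∀ s, ∀ q ∈ R.sent i s, q.1 ∈ A → T < s + (R.delay i s q : ℕ)

open Classical in
theorem IsolatedUntil.inbox_eq {R : Run P} {S : System} {A : Finset ℕ} {T : ℕ}
    (h : R.IsolatedUntil S A T) (hA : A ⊆ S.procs) {j t : ℕ} (hj : j ∈ A) (ht : t ≤ T) :
    R.inbox S j t = ∑ s ∈ Finset.range t, ∑ i ∈ A,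
      ((R.sent i s).filter fun q => q.1 = j ∧ s + (R.delay i s q : ℕ) = t).val.map
        fun q => (i, q.2) := by
  unfold inbox
  refine Finset.sum_congr rfl fun s _ => (Finset.sum_subset hA fun i hi hiA => ?_).symm
  rw [Finset.filter_eq_empty_iff.2]
  · rfl
  · rintro q hq ⟨rfl, hqt⟩
    have := h i hi hiA s q hq hj
    omega

/-- Up to tick `T` the members of `A` hear only each other, so they evolve as a closed deterministic
system. -/
theorem IsolatedUntil.state_eq {R R' : Run P} {S S' : System} {A : Finset ℕ} {T : ℕ}
    (h : R.IsolatedUntil S A T) (h' : R'.IsolatedUntil S' A T)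
    (hA : A ⊆ S.correct) (hA' : A ⊆ S'.correct)
    (hR : ∀ i ∈ A, R.BehavesCorrectly S i) (hR' : ∀ i ∈ A, R'.BehavesCorrectly S' i)
    (hpd : ∀ i ∈ A, S.pd i = S'.pd i) (hprop : ∀ i ∈ A, R.proposal i = R'.proposal i)
    (hdelay : ∀ i ∈ A, ∀ s q, q.1 ∈ A → R.delay i s q = R'.delay i s q)
    {t : ℕ} (ht : t ≤ T) {i : ℕ} (hi : i ∈ A) : R.state i t = R'.state i t := by
  -- The induction must carry the sent messages too: delays are positive, so the inbox at a tick
  -- depends only on what was sent at earlier ticks.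
  suffices h : ∀ i ∈ A, R.state i t = R'.state i t ∧ R.sent i t = R'.sent i t from (h i hi).1
  induction t using Nat.strong_induction_on with
  | _ t ih =>
    have hinbox : ∀ s ≤ t, ∀ i ∈ A, R.inbox S i s = R'.inbox S' i s := by
      intro s hs j hj
      rw [h.inbox_eq (hA.trans Finset.sdiff_subset) hj (hs.trans ht),
        h'.inbox_eq (hA'.trans Finset.sdiff_subset) hj (hs.trans ht)]
      refine Finset.sum_congr rfl fun r hr => Finset.sum_congr rfl fun i hi => ?_
      have hr := Finset.mem_range.1 hr
      rw [(ih r (by omega) (by omega) i hi).2]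
      congr 2
      refine Finset.filter_congr fun q _ => and_congr_right fun hq => ?_
      rw [hdelay i hi r q (hq ▸ hj)]
    intro i hi
    have hstate : R.state i t = R'.state i t := by
      cases t with
      | zero => rw [(hR i hi).1, (hR' i hi).1, hpd i hi, hprop i hi]
      | succ t =>
        rw [((hR i hi).2 t).1, ((hR' i hi).2 t).1, hinbox t (by omega) i hi,
          (ih t (by omega) (by omega) i hi).1]
    refine ⟨hstate, ?_⟩
    rw [((hR i hi).2 t).2, ((hR' i hi).2 t).2]
    exact prescribed_congr (hpd i hi) hstate fun s hs => hinbox s hs i hi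

/-- The run of the merged system in which the messages between `{0, 1, 2}` and `{3, 4, 5}` are
delayed beyond tick `T`. -/
noncomputable def merged (P : Protocol.{u, v} V) (proposal : ℕ → V) (T : ℕ) : Run P :=
  silent mergedSystem proposal fun i _ q => if i < 3 ↔ q.1 < 3 then 1 else T.succPNat

/-- The bound `T + 1` may depend on the run, since partial synchrony leaves `δ` unknown. -/
theorem merged_isExecution (proposal : ℕ → V) (T : ℕ) (fm : FaultModel) :
    (merged P proposal T).IsExecution mergedSystem fm :=
  silent_isExecution _ _ _ fm (δ := T + 1) fun i t q => by split_ifs <;> simp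

/-- The run of a group of participants whose faulty member is silent, with immediate delivery. -/
noncomputable def solo (P : Protocol.{u, v} V) (Q : Finset ℕ) (x : ℕ) (hx : x ∈ Q) (d : V) : Run P :=
  silent (soloSystem Q x hx) (fun _ => d) fun _ _ _ => 1

theorem solo_isExecution {Q : Finset ℕ} {x : ℕ} (hx : x ∈ Q) (d : V) (fm : FaultModel) :
    (solo P Q x hx d).IsExecution (soloSystem Q x hx) fm :=
  silent_isExecution _ _ _ fm (δ := 1) fun _ _ _ => le_rfl

/-- The proposition `b` selects the half that equals `Q.erase x`. This half is isolated in the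
merged run by slow messages, and in the solo run because the only outsider `x` is silent. -/
theorem merged_state_eq_solo {Q : Finset ℕ} {x : ℕ} (hx : x ∈ Q) {d : V} {proposal : ℕ → V} {T t : ℕ}
    (hside : ∃ b : Prop, ∀ i ∈ Finset.range 6, (i < 3 ↔ b) ↔ i ∈ Q.erase x)
    (hQ : Q ⊆ Finset.range 6) (hpd : ∀ i ∈ Q.erase x, mergedSystem.pd i = Q)
    (hprop : ∀ i ∈ Q.erase x, proposal i = d) (ht : t ≤ T) {i : ℕ} (hi : i ∈ Q.erase x) :
    (merged P proposal T).state i t = (solo P Q x hx d).state i t := by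
  obtain ⟨b, hb⟩ := hside
  have hmem : ∀ i ∈ Q.erase x, i ∈ Finset.range 6 := fun i hi => hQ (Finset.mem_of_mem_erase hi)
  have hA : Q.erase x ⊆ mergedSystem.correct := mergedSystem_correct ▸ hmem
  have hA' : Q.erase x ⊆ (soloSystem Q x hx).correct := by
    simp [System.correct, soloSystem, Finset.sdiff_singleton_eq_erase]
  refine IsolatedUntil.state_eq (S := mergedSystem) (S' := soloSystem Q x hx) ?_ ?_ hA hA'
    (fun i hi => (merged_isExecution proposal T .crash).correct i (hA hi))
    (fun i hi => (solo_isExecution hx d .crash).correct i (hA' hi)) hpd hprop ?_ ht hi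
  · intro i hi hiA s q _ hqA
    have h1 := (hb i hi).not.2 hiA
    have h2 := (hb _ (hmem _ hqA)).2 hqA
    have h3 : ¬(i < 3 ↔ q.1 < 3) := fun h => h1 (h.trans h2)
    simp only [merged, silent, h3, if_false, Nat.succPNat_coe]
    omega
  · intro i hi hiA s q hq
    obtain rfl : i = x := by
      by_contra hne
      exact hiA (Finset.mem_erase.2 ⟨hne, hi⟩)
    rw [solo, silent_sent_of_faulty _ _ _ (by simp [soloSystem])] at hq
    simp at hq
  · intro i hi s q hq
    exact if_pos (((hb i (hmem i hi)).2 hi).trans ((hb _ (hmem _ hq)).2 hq).symm)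

end Run

/-! ### Decisions forced by Termination and Validity -/

theorem Protocol.exists_solo_decision {V : Type u} {P : Protocol.{u, v} V} {valid : V → Prop}
    {fm : FaultModel} {Q : Finset ℕ} {x : ℕ} {hx : x ∈ Q}
    (h : P.SolvesConsensus valid fm (soloSystem Q x hx)) {d : V} (hd : valid d) {i : ℕ}
    (hi : i ∈ Q.erase x) : ∃ e t, P.decision ((Run.solo P Q x hx d).state i t) = some e :=
  (h _ (Run.solo_isExecution hx d fm) fun _ _ => hd).termination i
    (by simpa [System.correct, soloSystem, Finset.sdiff_singleton_eq_erase] using hi)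

theorem Protocol.decides_eq_of_merged {V : Type u} {P : Protocol.{u, v} V} {valid : V → Prop}
    {fm : FaultModel} (h : P.SolvesConsensus valid fm mergedSystem) {d e : V} (hd : valid d)
    {T i : ℕ} (hi : i ∈ Finset.range 6)
    (hdec : (Run.merged P (fun _ => d) T).Decides i e) : d = e := by
  obtain ⟨-, p, -, hp | hp⟩ := (h _ (Run.merged_isExecution (fun _ => d) T fm)
    fun _ _ => hd).validity i (mergedSystem_correct ▸ hi) e hdec
  · exact hp
  · simp [mergedSystem] at hp

end CUP

theorem mainTheorem2 {V : Type u} (valid : V → Prop)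
    (hvalid : ∃ a b : V, valid a ∧ valid b ∧ a ≠ b) (fm : CUP.FaultModel) :
    ¬ ∃ P : CUP.Protocol.{u, v} V, ∀ (S : CUP.System) (f : ℕ),
      S.faulty.card ≤ f → S.SatisfiesBFTCUP f → P.SolvesConsensus valid fm S := by
  open CUP in
  rintro ⟨P, hP⟩
  obtain ⟨a, b, ha, hb, hab⟩ := hvalid
  have hsolo (Q : Finset ℕ) (x : ℕ) (hx : x ∈ Q) (hQ : Q.card = 4) :=
    hP (soloSystem Q x hx) 1 (by simp [soloSystem]) (soloSystem_satisfiesBFTCUP hx hQ)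
  have hmerged := hP mergedSystem 0 (by simp [mergedSystem]) mergedSystem_satisfiesBFTCUP
  have h3 : 3 ∈ ({0, 1, 2, 3} : Finset ℕ) := by decide
  have h0 : 0 ∈ ({0, 3, 4, 5} : Finset ℕ) := by decide
  obtain ⟨d, t, hd⟩ := Protocol.exists_solo_decision (hsolo _ 3 h3 rfl) ha (i := 1) (by decide)
  obtain ⟨e, s, he⟩ := Protocol.exists_solo_decision (hsolo _ 0 h0 rfl) hb (i := 4) (by decide)
  -- Taking `T = max t s` lets both halves decide before any cross message arrives. Proposals of the
  -- other half stay free, so this covers both the unanimous and the split run.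
  have hdec1 {p : ℕ → V} (hp : ∀ i < 3, p i = a) : (Run.merged P p (max t s)).Decides 1 d := by
    refine ⟨t, ?_⟩
    rwa [Run.merged_state_eq_solo h3 ⟨True, by decide⟩ (by decide) (by decide)
      (fun i hi => hp i ((by decide : ∀ i ∈ ({0, 1, 2, 3} : Finset ℕ).erase 3, i < 3) i hi))
      (le_max_left t s) (by decide)]
  have hdec2 {p : ℕ → V} (hp : ∀ i, 3 ≤ i → p i = b) : (Run.merged P p (max t s)).Decides 4 e := by
    refine ⟨s, ?_⟩
    rwa [Run.merged_state_eq_solo h0 ⟨False, by decide⟩ (by decide) (by decide)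
      (fun i hi => hp i ((by decide : ∀ i ∈ ({0, 3, 4, 5} : Finset ℕ).erase 0, 3 ≤ i) i hi))
      (le_max_right t s) (by decide)]
  -- The unanimous runs show that the two solo decisions are `a` and `b`.
  obtain rfl := Protocol.decides_eq_of_merged hmerged ha (by decide) (hdec1 fun _ _ => rfl)
  obtain rfl := Protocol.decides_eq_of_merged hmerged hb (by decide) (hdec2 fun _ _ => rfl)
  refine hab ((hmerged _ (Run.merged_isExecution (fun i => if i < 3 then a else b) (max t s) fm)
    fun i _ => ?_).agreement 1 (by decide) 4 (by decide) a b
    (hdec1 fun i hi => if_pos hi) (hdec2 fun i hi => if_neg (by omega)))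
  dsimp only [Run.merged, Run.silent]
  split_ifs <;> assumption
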